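/- Let $\mathrm{cov}(\mathcal N)$ be the least cardinality of a family of Lebesgue null subsets of $[0,1]$ whose union is $[0,1]$, and let $\mathfrak c$ be the cardinality of $\mathbb R$. For a directed set $\mathcal A$ (a nonempty preordered set in which every two elements have an upper bound), let $\mathcal{AN}_{\mathcal A}$ be the family of nets $(f_A)_{A\in\mathcal A}$ of Lebesgue measurable functions $f_A\colon\mathbb R\to\mathbb R$ that converge almost everywhere to some function $f\colon\mathbb R\to\mathbb R$ that is not Lebesgue measurable. It is a subset of the commutative real algebra $(\mathbb R^{\mathbb R})^{\mathcal A}$ with pointwise operations. A subset $M$ of a commutative real algebra is called strongly $\kappa$-algebrable if there are a (not necessarily unital) subalgebra $B$ with $B\setminus\{0\}\subseteq M$ and a set $S$ of cardinality $\kappa$ generating $B$ such that $P(s_1,\dots,s_n)\neq 0$ for all distinct $s_1,\dots,s_n\in S$ and every nonzero real polynomial $P$ in $n$ variables without constant term. **Theorem.** There exists a directed set $\mathcal A$ that is not a cardinal number, with $\mathrm{card}(\mathcal A)=\mathrm{cov}(\mathcal N)$, such that $\mathcal{AN}_{\mathcal A}$ is strongly $2^{\mathfrak c}$-algebrable. More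 precisely, there is a family $X$ of Lebesgue null subsets of $\mathbb R$ with $\bigcup X=\mathbb R$ and $\mathrm{card}(X)=\mathrm{cov}(\mathcal N)$ such that the set $\mathcal A$ of all finite subsets of $X$, preordered by $A\preccurlyeq B$ if and only if $\bigcup A\subseteq\bigcup B$, is such a directed set; moreover $\mathcal A$ contains two incomparable elements, and in particular it is not order isomorphic to any cardinal number (initial ordinal). -/

import Mathlib

open MeasureTheory Filter Topology Cardinal

noncomputable section

/-- The covering number `cov(𝒩)`: the least cardinality of a family of Lebesgue null subsets of
`[0,1]` whose union is `[0,1]`. -/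
def covNull : Cardinal.{0} :=
  sInf {κ | ∃ X : Set (Set ℝ), (∀ N ∈ X, N ⊆ Set.Icc 0 1 ∧ volume N = 0) ∧
    ⋃₀ X = Set.Icc 0 1 ∧ #X = κ}

/-- The set of all finite subsets of a family `X` of sets of reals. It is a type of its own, since
it does not carry the inclusion order of `Finset`. -/
def FiniteSubfamily (X : Set (Set ℝ)) : Type := Finset X

/-- The union of the members of a finite subfamily. -/
def FiniteSubfamily.union {X : Set (Set ℝ)} (A : FiniteSubfamily X) : Set ℝ :=
  {x | ∃ N : X, N ∈ (show Finset X from A) ∧ x ∈ (N : Set ℝ)}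

/-- Finite subfamilies are preordered by inclusion of their unions. -/
instance FiniteSubfamily.instPreorder (X : Set (Set ℝ)) : Preorder (FiniteSubfamily X) :=
  Preorder.lift FiniteSubfamily.union

/-- The preordered set `𝒜` is (order isomorphic to) a cardinal number, that is, an initial ordinal
with its usual order. -/
def IsCardinalNumber (𝒜 : Type) [Preorder 𝒜] : Prop :=
  ∃ κ : Cardinal.{0}, Nonempty (𝒜 ≃o κ.ord.ToType)

/-- The nets `(f_A)` of Lebesgue measurable functions `ℝ → ℝ` that converge almost everywhere to a
function that is not Lebesgue measurable. (`NullMeasurable` for `volume` is measurability with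
respect to the completion of the Borel sets, i.e. Lebesgue measurability.) -/
def netsAN (𝒜 : Type) [Preorder 𝒜] : Set (𝒜 → ℝ → ℝ) :=
  {F | (∀ A, NullMeasurable (F A) volume) ∧
    ∃ f : ℝ → ℝ, ¬ NullMeasurable f volume ∧
      ∀ᵐ x ∂volume, Tendsto (fun A => F A x) atTop (𝓝 (f x))}

/-- `S` is a set of free generators of the (not necessarily unital) subalgebra `B` of the
commutative algebra `V`: it generates `B`, and no nonzero polynomial without constant term vanishes
at distinct elements of `S`. -/
def IsFreeGenerators (K : Type*) {V : Type*} [Field K] [CommRing V] [Algebra K V]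
    (S : Set V) (B : NonUnitalSubalgebra K V) : Prop :=
  NonUnitalAlgebra.adjoin K S = B ∧
    ∀ P : MvPolynomial S K, MvPolynomial.constantCoeff P = 0 →
      MvPolynomial.aeval (fun s : S => (s : V)) P = 0 → P = 0

/-- `A` is strongly `κ`-algebrable: there is a `κ`-generated free algebra `B` with
`B \ {0} ⊆ A`. -/
def StronglyAlgebrable (K : Type*) {V : Type*} [Field K] [CommRing V] [Algebra K V]
    (κ : Cardinal) (A : Set V) : Prop :=
  ∃ (B : NonUnitalSubalgebra K V) (S : Set V),
    #S = κ ∧ IsFreeGenerators K S B ∧ (B : Set V) \ {0} ⊆ A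

end

/-! Cutting a function off to a null set gives a function that is zero a.e., hence measurable, while
along finite unions from a cover by null sets the cut-offs converge at every point to the original
function. Polynomials without constant term commute with cutting off, so it suffices to find `2 ^ 𝔠`
functions at which all such nonzero polynomials are non-measurable
(`exists_free_nonmeasurable_functions`). These are `h s ∘ π`, where `π` has non-null fibres and the
`h s` jointly take any prescribed finite tuple of values. Each value of a polynomial is then
attained on a non-null set, and there are uncountably many values, whereas a measurable function has
only countably many non-null level sets. -/

/-- Nonzero polynomials without constant term, evaluated at a family of elements that they send
to nonzero members of `A`, exhibit strong algebrability. -/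
theorem stronglyAlgebrable_of_aeval {K V T : Type*} [Field K] [CommRing V] [Algebra K V]
    {A : Set V} (G : T → V)
    (hG : ∀ P : MvPolynomial T K, P ≠ 0 → MvPolynomial.constantCoeff P = 0 →
      MvPolynomial.aeval G P ∈ A ∧ MvPolynomial.aeval G P ≠ 0) :
    StronglyAlgebrable K #(Set.range G) A ∧ Function.Injective G := by
  have hinj : Function.Injective G := by
    intro s t hst
    by_contra hne
    refine (hG (MvPolynomial.X s - MvPolynomial.X t) ?_ (by simp)).2 (by simp [hst])
    rw [sub_ne_zero]
    exact fun h => hne (MvPolynomial.X_injective h)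
  refine ⟨⟨NonUnitalAlgebra.adjoin K (Set.range G), Set.range G, rfl, ⟨rfl, ?_⟩, ?_⟩, hinj⟩
  · intro P hP h0
    let e := Equiv.ofInjective G hinj
    have hval : (fun s : Set.range G => (s : V)) = G ∘ e.symm := by
      funext s
      exact (Equiv.apply_ofInjective_symm hinj s).symm
    by_contra hne
    refine (hG (MvPolynomial.rename e.symm P) ?_ ?_).2 ?_
    · rwa [Ne, map_eq_zero_iff _ (MvPolynomial.rename_injective _ e.symm.injective)]
    · rwa [MvPolynomial.constantCoeff_rename]
    · rwa [MvPolynomial.aeval_rename, ← hval]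
  · rintro v ⟨hv, hv0⟩
    obtain ⟨P, hP, rfl⟩ : ∃ P : MvPolynomial T K,
        MvPolynomial.constantCoeff P = 0 ∧ MvPolynomial.aeval G P = v := by
      refine NonUnitalAlgebra.adjoin_induction (p := fun v _ => ∃ P : MvPolynomial T K,
        MvPolynomial.constantCoeff P = 0 ∧ MvPolynomial.aeval G P = v) ?_ ?_ ?_ ?_ ?_ hv
      · rintro _ ⟨t, rfl⟩
        exact ⟨MvPolynomial.X t, by simp, by simp⟩
      · rintro _ _ _ _ ⟨P, hP, rfl⟩ ⟨Q, hQ, rfl⟩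
        exact ⟨P + Q, by simp [hP, hQ], by simp⟩
      · exact ⟨0, by simp, by simp⟩
      · rintro _ _ _ _ ⟨P, hP, rfl⟩ ⟨Q, hQ, rfl⟩
        exact ⟨P * Q, by simp [hP], by simp⟩
      · rintro r _ _ ⟨P, hP, rfl⟩
        exact ⟨r • P, by simp [MvPolynomial.smul_eq_C_mul, hP], by simp⟩
    refine (hG P ?_ hP).1
    rintro rfl
    exact hv0 (by simp)

/-! ### Non-measurable functions from a Hamel basis and an independent family -/

/-- There is a map from `ℝ` onto `ℝ →₀ ℚ` all of whose fibres are non-null. -/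
theorem exists_linearMap_fibres_ne_null :
    ∃ π : ℝ →ₗ[ℚ] (ℝ →₀ ℚ), ∀ y, volume (π ⁻¹' {y}) ≠ 0 := by
  let b₀ := Module.Basis.ofVectorSpace ℚ ℝ
  have hcard : #(Module.Basis.ofVectorSpaceIndex ℚ ℝ) = #(ℕ × ℝ) := by
    rw [b₀.mk_eq_rank'', Real.rank_rat_real]
    simp [mk_real]
  obtain ⟨e⟩ := Cardinal.eq.1 hcard
  -- The Hamel basis is split into countably many blocks of size `𝔠`, and `π n` reads the
  -- coordinates in block `n`. A real has finite support, so it misses some block: the kernels cover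
  -- the line, and one of them is non-null. All fibres are translates of the kernel.
  let b := b₀.reindex e
  let π : ℕ → ℝ →ₗ[ℚ] (ℝ →₀ ℚ) := fun n =>
    Finsupp.lcomapDomain (fun t : ℝ => (n, t)) (Prod.mk_right_injective n) ∘ₗ b.repr.toLinearMap
  have hπ : ∀ n x t, π n x t = b.repr x (n, t) := fun n x t => rfl
  have hsurj : ∀ n y, ∃ x, π n x = y := by
    intro n y
    refine ⟨b.repr.symm (y.mapDomain (fun t => (n, t))), ?_⟩
    ext t
    rw [hπ, LinearEquiv.apply_symm_apply, Finsupp.mapDomain_apply (Prod.mk_right_injective n)]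
  have hcover : (⋃ n, π n ⁻¹' {0}) = Set.univ := by
    refine Set.eq_univ_of_forall fun x => ?_
    obtain ⟨n, hn⟩ := Infinite.exists_notMem_finset ((b.repr x).support.image Prod.fst)
    refine Set.mem_iUnion.2 ⟨n, ?_⟩
    ext t
    rw [hπ]
    by_contra h
    exact hn (Finset.mem_image.2 ⟨(n, t), Finsupp.mem_support_iff.2 h, rfl⟩)
  obtain ⟨n, hn⟩ : ∃ n, volume (π n ⁻¹' {0}) ≠ 0 := by
    by_contra! h
    have := measure_iUnion_null h
    rw [hcover] at this
    simp at this
  refine ⟨π n, fun y => ?_⟩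
  obtain ⟨x, rfl⟩ := hsurj n y
  have : π n ⁻¹' {0} = (fun z => z + x) ⁻¹' (π n ⁻¹' {π n x}) := by
    ext z
    simp
  rwa [this, measure_preimage_add_right] at hn

/-- Any type of the cardinality of the continuum is the target of a map from `ℝ` with non-null
fibres. -/
theorem exists_map_fibres_ne_null {I : Type} (hI : #I = 𝔠) :
    ∃ π : ℝ → I, ∀ i, volume (π ⁻¹' {i}) ≠ 0 := by
  obtain ⟨π, hπ⟩ := exists_linearMap_fibres_ne_null
  obtain ⟨e⟩ : Nonempty ((ℝ →₀ ℚ) ≃ I) := Cardinal.eq.1 (by simp [hI, mk_real, aleph0_le_continuum])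
  refine ⟨e ∘ π, fun i => ?_⟩
  convert hπ (e.symm i) using 2
  ext x
  simp [Equiv.eq_symm_apply]

/-- A function with uncountably many non-null level sets is not measurable. -/
theorem not_nullMeasurable_of_uncountable_levels {f : ℝ → ℝ}
    (hf : ¬ {r | volume (f ⁻¹' {r}) ≠ 0}.Countable) : ¬ NullMeasurable f volume := by
  intro hm
  apply hf
  simpa [pos_iff_ne_zero] using! Measure.countable_meas_level_set_pos₀ hm

/-- Finitely many distinct sets have distinct traces on a suitable finite set. -/
theorem exists_finset_injOn_filter {α : Type*} (W : Finset (Set α)) :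
    ∃ F : Finset α, Set.InjOn (fun s : Set α => (s ∩ F : Set α)) W := by
  classical
  rcases isEmpty_or_nonempty α with hα | hα
  · exact ⟨∅, fun s _ t _ _ => Subsingleton.elim s t⟩
  have h : ∀ s t : Set α, ∃ a, s ≠ t → ¬ (a ∈ s ↔ a ∈ t) := by
    intro s t
    by_cases hst : s = t
    · exact ⟨Classical.arbitrary α, fun h => absurd hst h⟩
    · obtain ⟨a, ha⟩ := not_forall.1 (mt Set.ext hst)
      exact ⟨a, fun _ => ha⟩
  choose d hd using h
  refine ⟨Finset.image₂ d W W, fun s hs t ht hst => ?_⟩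
  by_contra hne
  have hmem : d s t ∈ Finset.image₂ d W W := Finset.mem_image₂_of_mem hs ht
  have := Set.ext_iff.1 hst (d s t)
  simp only [Set.mem_inter_iff, Finset.mem_coe, hmem, and_true] at this
  exact hd s t hne this

/-- A strongly independent family of `2 ^ 𝔠` real functions on a set of cardinality `𝔠`. -/
theorem exists_independent_functions :
    ∃ (I : Type) (h : Set ℝ → I → ℝ), #I = 𝔠 ∧
      ∀ (W : Finset (Set ℝ)) (t : Set ℝ → ℝ), ∃ i, ∀ s ∈ W, h s i = t s := by
  classical
  -- An index is a finite set `F` with a table of values on finite sets; `h s` looks up the trace of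
  -- `s` on `F`. Once `F` separates the members of `W`, their values can be chosen independently.
  refine ⟨Finset ℝ × (Finset ℝ →₀ ℝ), fun s i => i.2 (i.1.filter (· ∈ s)), by simp [mk_real], ?_⟩
  intro W t
  obtain ⟨F, hF⟩ := exists_finset_injOn_filter W
  have hF' : Set.InjOn (fun s : Set ℝ => F.filter (· ∈ s)) W := by
    intro s hs u hu hsu
    apply hF hs hu
    ext a
    have := Finset.ext_iff.1 hsu a
    simp only [Finset.mem_filter] at this
    simp only [Set.mem_inter_iff, Finset.mem_coe]
    tauto
  refine ⟨(F, ∑ u ∈ W, Finsupp.single (F.filter (· ∈ u)) (t u)), fun s hs => ?_⟩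
  simp only [Finsupp.finsetSum_apply]
  rw [Finset.sum_eq_single_of_mem s hs, Finsupp.single_eq_same]
  intro u hu hus
  exact Finsupp.single_eq_of_ne fun h => hus (hF' hu hs h.symm)

/-- There are `2 ^ 𝔠` real functions at which every nonzero polynomial without constant term is
non-measurable. -/
theorem exists_free_nonmeasurable_functions :
    ∃ g : Set ℝ → ℝ → ℝ, ∀ P : MvPolynomial (Set ℝ) ℝ, P ≠ 0 →
      MvPolynomial.constantCoeff P = 0 →
        ¬ NullMeasurable (fun x => MvPolynomial.eval (fun s => g s x) P) volume := by
  obtain ⟨I, h, hI, hind⟩ := exists_independent_functions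
  obtain ⟨π, hπ⟩ := exists_map_fibres_ne_null hI
  refine ⟨fun s x => h s (π x), fun P hP hP0 => ?_⟩
  have hvalue : ∀ t : Set ℝ → ℝ, volume ((fun x => MvPolynomial.eval (fun s => h s (π x)) P) ⁻¹'
      {MvPolynomial.eval t P}) ≠ 0 := by
    intro t
    obtain ⟨i, hi⟩ := hind P.vars t
    refine fun h0 => hπ i (measure_mono_null ?_ h0)
    rintro x rfl
    exact MvPolynomial.eval₂Hom_congr' rfl (fun s hs _ => hi s hs) rfl
  obtain ⟨t, ht⟩ : ∃ t, MvPolynomial.eval t P ≠ 0 := by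
    by_contra! hall
    exact hP (MvPolynomial.funext fun t => by simpa using hall t)
  apply not_nullMeasurable_of_uncountable_levels
  intro hcount
  -- On the segment from `0` to `t` the polynomial runs continuously from `0`, by the missing
  -- constant term, to a nonzero value, so it takes a whole interval of values.
  have hcont : Continuous fun r : ℝ => MvPolynomial.eval (r • t) P := by
    exact (MvPolynomial.continuous_eval P).comp (by fun_prop)
  have hivt := intermediate_value_uIcc (a := 0) (b := 1) hcont.continuousOn
  have hzero : MvPolynomial.eval ((0 : ℝ) • t) P = 0 := by
    rw [zero_smul]
    exact (congrArg (fun φ => φ P) MvPolynomial.eval_zero).trans hP0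
  rw [hzero, one_smul] at hivt
  have hc : (Set.uIcc 0 (MvPolynomial.eval t P)).Countable := by
    refine hcount.mono fun r hr => ?_
    obtain ⟨r', -, rfl⟩ := hivt hr
    exact hvalue _
  have hc' := Cardinal.le_aleph0_iff_set_countable.2 hc
  rw [Set.uIcc, Cardinal.mk_Icc_real (by simpa using ht)] at hc'
  exact absurd hc' (not_le.2 Cardinal.aleph0_lt_continuum)

/-! ### Covers by null sets -/

theorem covNull_spec : ∃ Y : Set (Set ℝ), (∀ N ∈ Y, N ⊆ Set.Icc 0 1 ∧ volume N = 0) ∧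
    ⋃₀ Y = Set.Icc 0 1 ∧ #Y = covNull := by
  refine csInf_mem (s := {κ : Cardinal.{0} | ∃ X : Set (Set ℝ),
    (∀ N ∈ X, N ⊆ Set.Icc 0 1 ∧ volume N = 0) ∧ ⋃₀ X = Set.Icc 0 1 ∧ #X = κ}) ?_
  refine ⟨_, (fun x : ℝ => ({x} : Set ℝ)) '' Set.Icc 0 1, ?_, ?_, rfl⟩
  · rintro _ ⟨x, hx, rfl⟩
    exact ⟨by simpa using hx, by simp⟩
  · ext x
    simp

theorem aleph0_le_covNull : ℵ₀ ≤ covNull := by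
  obtain ⟨Y, hY, hU, hc⟩ := covNull_spec
  rw [← hc]
  by_contra! h
  have hnull := (measure_sUnion_null_iff (μ := (volume : Measure ℝ))
    (Cardinal.le_aleph0_iff_set_countable.1 h.le)).2 fun N hN => (hY N hN).2
  rw [hU] at hnull
  simp at hnull

/-- Every cover of the line by null sets has at least `covNull` members. -/
theorem covNull_le_of_cover {X : Set (Set ℝ)} (hX : ∀ N ∈ X, volume N = 0)
    (hU : ⋃₀ X = Set.univ) : covNull ≤ #X := by
  refine (csInf_le' ?_ : covNull ≤ #((fun N => N ∩ Set.Icc (0 : ℝ) 1) '' X)).trans mk_image_le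
  refine ⟨_, ?_, ?_, rfl⟩
  · rintro _ ⟨N, hN, rfl⟩
    exact ⟨Set.inter_subset_right, measure_mono_null Set.inter_subset_left (hX N hN)⟩
  · rw [Set.sUnion_image, ← Set.iUnion₂_inter, ← Set.sUnion_eq_biUnion, hU, Set.univ_inter]

/-- An optimal cover of the line by null sets, two of whose members are incomparable. -/
theorem exists_optimal_cover : ∃ X : Set (Set ℝ), (∀ N ∈ X, volume N = 0) ∧
    ⋃₀ X = Set.univ ∧ #X = covNull ∧ ∃ M ∈ X, ∃ N ∈ X, ¬ M ⊆ N ∧ ¬ N ⊆ M := by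
  obtain ⟨Y, hY, hU, hc⟩ := covNull_spec
  -- Integer translates of an optimal cover of the unit interval; as `covNull` is infinite,
  -- countably many copies do not raise the cardinality.
  let τ : ℤ × Y → Set ℝ := fun p => (fun x => x - (p.1 : ℝ)) ⁻¹' p.2
  have hnull : ∀ N ∈ Set.range τ, volume N = 0 := by
    rintro _ ⟨⟨k, N, hN⟩, rfl⟩
    simp only [τ, sub_eq_add_neg, measure_preimage_add_right]
    exact (hY N hN).2
  have hcover : ⋃₀ Set.range τ = Set.univ := by
    refine Set.eq_univ_of_forall fun x => ?_
    have hx : x - (⌊x⌋ : ℝ) ∈ ⋃₀ Y := by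
      rw [hU]
      exact ⟨Int.fract_nonneg x, (Int.fract_lt_one x).le⟩
    obtain ⟨N, hN, hxN⟩ := hx
    exact ⟨_, ⟨(⌊x⌋, ⟨N, hN⟩), rfl⟩, hxN⟩
  refine ⟨Set.range τ, hnull, hcover, le_antisymm ?_ (covNull_le_of_cover hnull hcover), ?_⟩
  · refine mk_range_le.trans ?_
    rw [Cardinal.mk_prod, hc]
    simp [aleph0_le_covNull]
  · obtain ⟨N, hN, h0⟩ : (0 : ℝ) ∈ ⋃₀ Y := by
      rw [hU]
      simp
    -- A shift by 2 moves a nonempty subset of the unit interval off that interval.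
    refine ⟨_, ⟨(0, ⟨N, hN⟩), rfl⟩, _, ⟨(2, ⟨N, hN⟩), rfl⟩, fun h => ?_, fun h => ?_⟩
    · have := (hY N hN).1 (h (show (0 : ℝ) ∈ τ (0, ⟨N, hN⟩) by simpa [τ] using h0))
      norm_num at this
    · have := (hY N hN).1 (h (show (2 : ℝ) ∈ τ (2, ⟨N, hN⟩) by simpa [τ] using h0))
      norm_num at this

/-! ### The directed set and its nets -/

namespace FiniteSubfamily

variable {X : Set (Set ℝ)}

/-- The subfamily with a single member. -/
def single (N : X) : FiniteSubfamily X := ({N} : Finset X)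

theorem union_single (N : X) : (single N).union = N := by
  ext x
  constructor
  · rintro ⟨M, hM, hx⟩
    rwa [← Finset.mem_singleton.1 hM]
  · exact fun hx => ⟨N, Finset.mem_singleton_self N, hx⟩

theorem le_iff {A B : FiniteSubfamily X} : A ≤ B ↔ A.union ⊆ B.union := Iff.rfl

theorem isDirectedOrder (X : Set (Set ℝ)) : IsDirectedOrder (FiniteSubfamily X) := by
  classical
  refine ⟨fun A B => ⟨((show Finset X from A) ∪ (show Finset X from B) : Finset X), ?_, ?_⟩⟩
  · rintro x ⟨N, hN, hx⟩
    exact ⟨N, Finset.mem_union_left _ hN, hx⟩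
  · rintro x ⟨N, hN, hx⟩
    exact ⟨N, Finset.mem_union_right _ hN, hx⟩

theorem volume_union (hX : ∀ N ∈ X, volume N = 0) (A : FiniteSubfamily X) :
    volume A.union = 0 := by
  let F : Finset X := A
  have hF : A.union ⊆ ⋃ N ∈ (F : Set X), (N : Set ℝ) := by
    rintro x ⟨N, hN, hx⟩
    exact Set.mem_iUnion₂.2 ⟨N, hN, hx⟩
  exact measure_mono_null hF
    ((measure_biUnion_null_iff F.countable_toSet).2 fun N _ => hX N N.2)

/-- For a cover by null sets, the nets on the finite subfamilies which cut off given functions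
generate a free algebra of nets that converge to non-measurable functions. -/
theorem stronglyAlgebrable_netsAN (hX : ∀ N ∈ X, volume N = 0) (hU : ⋃₀ X = Set.univ) :
    StronglyAlgebrable ℝ (2 ^ 𝔠) (netsAN (FiniteSubfamily X)) := by
  classical
  obtain ⟨g, hg⟩ := exists_free_nonmeasurable_functions
  let G : Set ℝ → FiniteSubfamily X → ℝ → ℝ := fun s A => A.union.indicator (g s)
  have heval : ∀ (P : MvPolynomial (Set ℝ) ℝ) A x, MvPolynomial.aeval G P A x = MvPolynomial.eval (fun s => G s A x) P := by
    intro P A x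
    let φ : (FiniteSubfamily X → ℝ → ℝ) →ₐ[ℝ] ℝ :=
      (Pi.evalAlgHom ℝ (fun _ : ℝ => ℝ) x).comp
        (Pi.evalAlgHom ℝ (fun _ : FiniteSubfamily X => ℝ → ℝ) A)
    exact MvPolynomial.comp_aeval_apply G φ P
  have hcut : ∀ P : MvPolynomial (Set ℝ) ℝ, MvPolynomial.constantCoeff P = 0 → ∀ A,
      MvPolynomial.aeval G P A =
        A.union.indicator fun x => MvPolynomial.eval (fun s => g s x) P := by
    intro P hP A
    ext x
    rw [heval]
    by_cases hx : x ∈ A.union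
    · simp [G, hx]
    · simp only [G, Set.indicator_of_notMem hx]
      exact (congrArg (fun φ => φ P) MvPolynomial.eval_zero).trans hP
  have key : ∀ P : MvPolynomial (Set ℝ) ℝ, P ≠ 0 → MvPolynomial.constantCoeff P = 0 →
      MvPolynomial.aeval G P ∈ netsAN (FiniteSubfamily X) ∧ MvPolynomial.aeval G P ≠ 0 := by
    intro P hP hP0
    refine ⟨⟨fun A => ?_, _, hg P hP hP0, ae_of_all _ fun x => ?_⟩, fun h0 => ?_⟩
    · rw [hcut P hP0]
      refine (measurable_zero.nullMeasurable (μ := volume) : NullMeasurable (0 : ℝ → ℝ) _).congr ?_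
      exact (indicator_meas_zero (volume_union hX A)).symm
    · obtain ⟨N, hN, hx⟩ : x ∈ ⋃₀ X := hU ▸ Set.mem_univ x
      refine tendsto_const_nhds.congr' ?_
      filter_upwards [eventually_ge_atTop (single ⟨N, hN⟩)] with A hA
      rw [hcut P hP0, Set.indicator_of_mem]
      exact le_iff.1 hA (by rwa [union_single])
    -- If the net vanished, so would its pointwise limit, since the sets cover the line; but the
    -- limit is non-measurable.
    · refine hg P hP hP0 ?_
      convert (measurable_zero.nullMeasurable (μ := volume) : NullMeasurable (0 : ℝ → ℝ) _)
        using 1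
      ext x
      obtain ⟨N, hN, hx⟩ : x ∈ ⋃₀ X := hU ▸ Set.mem_univ x
      have := congrFun (hcut P hP0 (single ⟨N, hN⟩)) x
      rw [h0, Set.indicator_of_mem (by rwa [union_single])] at this
      exact this.symm
  obtain ⟨hS, hinj⟩ := stronglyAlgebrable_of_aeval G key
  rwa [mk_range_eq G hinj, mk_set, mk_real] at hS

end FiniteSubfamily

theorem not_isCardinalNumber_of_incomparable {𝒜 : Type} [Preorder 𝒜]
    (h : ∃ A B : 𝒜, ¬ A ≤ B ∧ ¬ B ≤ A) : ¬ IsCardinalNumber 𝒜 := by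
  rintro ⟨κ, ⟨e⟩⟩
  obtain ⟨A, B, hAB, hBA⟩ := h
  rcases le_total (e A) (e B) with h | h
  · exact hAB (e.le_iff_le.1 h)
  · exact hBA (e.le_iff_le.1 h)

theorem theorem2p10 :
    ∃ X : Set (Set ℝ),
      (∀ N ∈ X, volume N = 0) ∧ ⋃₀ X = Set.univ ∧ #X = covNull ∧
      Nonempty (FiniteSubfamily X) ∧
      IsDirectedOrder (FiniteSubfamily X) ∧
      (∃ A B : FiniteSubfamily X, ¬ A ≤ B ∧ ¬ B ≤ A) ∧
      ¬ IsCardinalNumber (FiniteSubfamily X) ∧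
      #(FiniteSubfamily X) = covNull ∧
      StronglyAlgebrable ℝ (2 ^ 𝔠) (netsAN (FiniteSubfamily X)) := by
  obtain ⟨X, hX, hU, hc, M, hM, N, hN, hMN, hNM⟩ := exists_optimal_cover
  have hinc : ∃ A B : FiniteSubfamily X, ¬ A ≤ B ∧ ¬ B ≤ A :=
    ⟨.single ⟨M, hM⟩, .single ⟨N, hN⟩, by
      simpa only [FiniteSubfamily.le_iff, FiniteSubfamily.union_single] using ⟨hMN, hNM⟩⟩
  have : Infinite X := Cardinal.infinite_iff.2 (hc ▸ aleph0_le_covNull)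
  exact ⟨X, hX, hU, hc, ⟨.single ⟨M, hM⟩⟩, FiniteSubfamily.isDirectedOrder X, hinc,
    not_isCardinalNumber_of_incomparable hinc, (mk_finset_of_infinite X).trans hc,
    FiniteSubfamily.stronglyAlgebrable_netsAN hX hU⟩
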